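/- A graph $G=(V,E)$ is a \emph{string graph} if there are continuous curves $\gamma_v:[0,1]\to\mathbb{R}^2$, one for each $v\in V$, such that for any two distinct vertices $v,w\in V$ the images of $\gamma_v$ and $\gamma_w$ intersect if and only if $\{v,w\}\in E$. The \emph{Heawood graph} is the graph with vertex set $\mathbb{Z}/14$ whose edges are the $14$ pairs $\{i,i+1\}$ for $i\in\mathbb{Z}/14$, together with the $7$ pairs $\{i,i+5\}$ for $i\in\mathbb{Z}/14$ odd. The Heawood graph is not a string graph. -/

import Mathlib

/-- A simple graph is a *string graph* if it is the intersection graph of curves in the plane: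
to every vertex `v` one can assign a continuous curve `γ v : [0,1] → ℝ²` such that, for any two
distinct vertices `v` and `w`, the images of `γ v` and `γ w` meet if and only if `v` and `w` are
adjacent. -/
def SimpleGraph.IsStringGraph {V : Type*} (G : SimpleGraph V) : Prop :=
  ∃ γ : V → C(unitInterval, EuclideanSpace ℝ (Fin 2)),
    ∀ v w : V, v ≠ w → ((Set.range (γ v) ∩ Set.range (γ w)).Nonempty ↔ G.Adj v w)

/-- The *Heawood graph*: its vertices are `0, …, 13`, and its 21 edges are the 14 edges
`{i, i + 1}` of a Hamiltonian cycle together with the 7 chords `{i, i + 5}` for `i` odd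
(addition in `Fin 14` is modulo 14), namely
`{1, 6}`, `{3, 8}`, `{5, 10}`, `{7, 12}`, `{9, 0}`, `{11, 2}` and `{13, 4}`. -/
def heawoodGraph : SimpleGraph (Fin 14) :=
  SimpleGraph.fromRel fun i j => j = i + 1 ∨ (i.val % 2 = 1 ∧ j = i + 5)

/-!
Suppose that curves `K v` in `ℂ` represent a graph `G`. Choose a point `p v` on every curve and,
for every edge `e`, a path from `p e.1` to `p e.2` in the union of the two curves at `e`. Call two
vertices far apart if they are distinct and not adjacent. The curves of far vertices `v`, `w` are
disjoint, so `p v - p w ≠ 0`; likewise the path of `e` minus `p w` avoids `0` when both ends of `e`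
are far from `w`. For two edges `e`, `f` with both ends of `e` far from both ends of `f`, the
difference of the two paths maps a whole square into `ℂ \ {0}`, so its boundary does not wind
around `0`. Measuring angles of `p v - p w` for `v < w`, and of `p w - p v` for `w < v`, the path of
`e` minus `p w` makes a number `x e w` of half turns, an integer which is odd exactly when `w` lies
between the ends of `e`; and the sum of `x` around every square is `0`. This is
`SimpleGraph.IsStringGraph.exists_halfTurns`. It says that the class in `H¹(–; ℤ/2)` of the double
cover of unordered by ordered pairs of far vertices, edges and squares lifts to an integral class.

For the Heawood graph the unordered squares form a closed surface: the edges far from a given edge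
form an 8-cycle, so each `(e, w)` lies on exactly two squares (`even_card_heawoodFarEdges`,
`sum_boundary_heawoodFarEdges`). Write `x` as its parity plus twice an integer function `y`, and add
up the relations over all squares. Modulo `4` the contribution of `2 * y` vanishes, since every
`y e w` is counted twice modulo `2`, but the parities contribute `2`
(`sum_betweenParity_heawoodFarEdges`), a contradiction. In other words, the Bockstein of the class
of the double cover is not zero on this surface, which is non-orientable.
-/

/-! ### Continuous logarithms -/

open Complex in
theorem exists_continuous_log {A : Type*} [TopologicalSpace A] [SimplyConnectedSpace A]
    [LocallyPathConnectedSpace A] {f : A → ℂ} (hf : Continuous f) (h0 : ∀ a, f a ≠ 0) :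
    ∃ l : A → ℂ, Continuous l ∧ ∀ a, exp (l a) = f a := by
  obtain ⟨a₀⟩ : Nonempty A := inferInstance
  obtain ⟨l, ⟨-, hl⟩, -⟩ := isCoveringMap_exp.existsUnique_continuousMap_lifts
    ⟨fun a => (⟨f a, h0 a⟩ : {z : ℂ // z ≠ 0}), by fun_prop⟩ a₀ (log (f a₀))
    (Subtype.ext (exp_log (h0 a₀)))
  exact ⟨l, l.continuous, fun a => congrArg Subtype.val (congrFun hl a)⟩

open Complex in
/-- Two continuous logarithms of proportional functions have the same increments. -/
theorem log_increment_eq {A : Type*} [TopologicalSpace A] [PreconnectedSpace A] {l l' : A → ℂ}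
    (hl : Continuous l) (hl' : Continuous l') (c : ℂ) (h : ∀ a, exp (l a) = c * exp (l' a))
    (a b : A) : l b - l a = l' b - l' a := by
  have key : l = fun x => l' x + (l a - l' a) := by
    refine isCoveringMap_exp.eq_of_comp_eq hl (by fun_prop) ?_ a (by ring)
    funext x
    refine Subtype.ext ?_
    simp only [Function.comp_apply, exp_add, exp_sub, h]
    field_simp [exp_ne_zero (l' a)]
  have := congrFun key b
  linear_combination this

open Complex in
theorem exists_int_of_exp_eq_one_or_neg_one {z : ℂ} (h : exp z = 1 ∨ exp z = -1) :
    ∃ n : ℤ, z = n * (Real.pi * I) ∧ (Even n ↔ exp z = 1) := by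
  rcases h with h | h
  · obtain ⟨n, hn⟩ := exp_eq_one_iff.1 h
    exact ⟨2 * n, by rw [hn]; push_cast; ring, by simp [h]⟩
  · obtain ⟨n, hn⟩ := exp_eq_one_iff.1 (show exp (z - Real.pi * I) = 1 by
      rw [exp_sub, h, exp_pi_mul_I]; norm_num)
    refine ⟨2 * n + 1, by push_cast; linear_combination hn, ?_⟩
    rw [h]
    norm_num [parity_simps]

/-! ### Half turns between curves in the plane -/

open Complex in
/-- A family of path-connected sets in the plane with intersection graph `G` assigns to every edge
`e` and every vertex `w` far from `e` a number `x e w` of half turns: its parity is prescribed by the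
order of the vertices, and its sum around the product of two far edges is zero. -/
theorem SimpleGraph.exists_halfTurns {V : Type*} [LinearOrder V] {G : SimpleGraph V}
    (K : V → Set ℂ) (hK : ∀ v, IsPathConnected (K v))
    (hG : ∀ v w, v ≠ w → ((K v ∩ K w).Nonempty ↔ G.Adj v w)) :
    ∃ x : V × V → V → ℤ,
      (∀ e w, G.Adj e.1 e.2 → Gᶜ.Adj e.1 w → Gᶜ.Adj e.2 w →
        (Even (x e w) ↔ (e.1 < w ↔ e.2 < w))) ∧
      (∀ e f, G.Adj e.1 e.2 → G.Adj f.1 f.2 → Gᶜ.Adj e.1 f.1 → Gᶜ.Adj e.1 f.2 →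
        Gᶜ.Adj e.2 f.1 → Gᶜ.Adj e.2 f.2 → x e f.1 + x f e.2 = x f e.1 + x e f.2) := by
  have hne : ∀ {v w}, Gᶜ.Adj v w → ∀ a ∈ K v, ∀ b ∈ K w, a - b ≠ 0 := by
    intro v w h a ha b hb hab
    rw [SimpleGraph.compl_adj] at h
    exact h.2 ((hG v w h.1).1 ⟨a, ha, sub_eq_zero.1 hab ▸ hb⟩)
  choose p hp using fun v => (hK v).nonempty
  -- The path of an edge is extended to all of `ℝ` by constants.
  have hpath : ∀ e : V × V, ∃ α : ℝ → ℂ, G.Adj e.1 e.2 →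
      Continuous α ∧ α 0 = p e.1 ∧ α 1 = p e.2 ∧ ∀ t, α t ∈ K e.1 ∪ K e.2 := by
    intro e
    by_cases he : G.Adj e.1 e.2
    · have hj := (((hK e.1).union (hK e.2) ((hG _ _ he.ne).2 he)).joinedIn
        (p e.1) (.inl (hp _)) (p e.2) (.inr (hp _)))
      refine ⟨hj.somePath.extend, fun _ => ⟨Path.continuous_extend _, by simp, by simp,
        fun t => ?_⟩⟩
      exact hj.somePath_mem _
    · exact ⟨fun _ => 0, fun h => absurd h he⟩
  choose α hα using hpath
  have hlog : ∀ (e : V × V) (w : V), ∃ l : ℝ → ℂ, G.Adj e.1 e.2 → Gᶜ.Adj e.1 w → Gᶜ.Adj e.2 w →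
      Continuous l ∧ ∀ t, exp (l t) = α e t - p w := by
    intro e w
    by_cases h : G.Adj e.1 e.2 ∧ Gᶜ.Adj e.1 w ∧ Gᶜ.Adj e.2 w
    · obtain ⟨he, h1, h2⟩ := h
      obtain ⟨hc, -, -, hm⟩ := hα e he
      obtain ⟨l, hl⟩ := exists_continuous_log (f := fun t => α e t - p w) (by fun_prop)
        (fun t => (hm t).elim (fun ht => hne h1 _ ht _ (hp w)) (fun ht => hne h2 _ ht _ (hp w)))
      exact ⟨l, fun _ _ _ => hl⟩
    · exact ⟨fun _ => 0, fun a b c => absurd ⟨a, b, c⟩ h⟩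
  choose l hl using hlog
  -- A logarithm of `p v - p w` or of its negative, depending only on the unordered pair.
  let θ : V → V → ℂ := fun v w => log (p (min v w) - p (max v w))
  have hθ_symm : ∀ v w, θ v w = θ w v := fun v w => by simp only [θ, min_comm, max_comm]
  have hθ : ∀ {v w}, Gᶜ.Adj v w → exp (θ v w) = (if v < w then 1 else -1) * (p v - p w) := by
    intro v w h
    rcases lt_or_gt_of_ne h.ne with hvw | hvw
    · simp only [θ, min_eq_left hvw.le, max_eq_right hvw.le, if_pos hvw, one_mul]
      exact exp_log (hne h _ (hp v) _ (hp w))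
    · simp only [θ, min_eq_right hvw.le, max_eq_left hvw.le, if_neg hvw.not_gt]
      rw [exp_log (hne h.symm _ (hp w) _ (hp v))]
      ring
  have hx : ∀ (e : V × V) (w : V), ∃ n : ℤ, G.Adj e.1 e.2 → Gᶜ.Adj e.1 w → Gᶜ.Adj e.2 w →
      l e w 1 - l e w 0 - θ e.2 w + θ e.1 w = n * (Real.pi * I) ∧
        (Even n ↔ (e.1 < w ↔ e.2 < w)) := by
    intro e w
    by_cases h : G.Adj e.1 e.2 ∧ Gᶜ.Adj e.1 w ∧ Gᶜ.Adj e.2 w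
    · obtain ⟨he, h1, h2⟩ := h
      obtain ⟨-, h0, h1', -⟩ := hα e he
      have hE : exp (l e w 1 - l e w 0 - θ e.2 w + θ e.1 w) =
          if (e.1 < w ↔ e.2 < w) then 1 else -1 := by
        have n1 := hne h1 _ (hp _) _ (hp _)
        have n2 := hne h2 _ (hp _) _ (hp _)
        rw [exp_add, exp_sub, exp_sub, (hl e w he h1 h2).2, (hl e w he h1 h2).2, hθ h1, hθ h2,
          h0, h1']
        by_cases a : e.1 < w <;> by_cases b : e.2 < w <;>
          simp only [a, b, if_true, if_false, iff_self, iff_true, iff_false, not_true] <;>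
          field_simp
      obtain ⟨n, hn, hn'⟩ := exists_int_of_exp_eq_one_or_neg_one (by rw [hE]; split_ifs <;> simp)
      refine ⟨n, fun _ _ _ => ⟨hn, hn'.trans ?_⟩⟩
      rw [hE]
      split_ifs with h <;> norm_num [h]
    · exact ⟨0, fun a b c => absurd ⟨a, b, c⟩ h⟩
  choose x hx using hx
  refine ⟨x, fun e w he h1 h2 => (hx e w he h1 h2).2, fun e f he hf h11 h12 h21 h22 => ?_⟩
  obtain ⟨cα, α0, α1, mα⟩ := hα e he
  obtain ⟨cβ, β0, β1, mβ⟩ := hα f hf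
  -- The map of the whole square into `ℂ \ {0}` has a continuous logarithm.
  obtain ⟨L, cL, hL⟩ := exists_continuous_log (f := fun z : ℝ × ℝ => α e z.1 - α f z.2)
    (by fun_prop) (by
      intro z
      rcases mα z.1 with h | h <;> rcases mβ z.2 with h' | h'
      exacts [hne h11 _ h _ h', hne h12 _ h _ h', hne h21 _ h _ h', hne h22 _ h _ h'])
  obtain ⟨c1, e1⟩ := hl e f.1 he h11 h21
  obtain ⟨c2, e2⟩ := hl e f.2 he h12 h22
  obtain ⟨c3, e3⟩ := hl f e.1 hf h11.symm h12.symm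
  obtain ⟨c4, e4⟩ := hl f e.2 hf h21.symm h22.symm
  have i1 := log_increment_eq c1 (l' := fun s => L (s, 0)) (by fun_prop) 1
    (fun s => by rw [e1, hL, β0]; ring) 0 1
  have i2 := log_increment_eq c2 (l' := fun s => L (s, 1)) (by fun_prop) 1
    (fun s => by rw [e2, hL, β1]; ring) 0 1
  have i3 := log_increment_eq c3 (l' := fun t => L (0, t)) (by fun_prop) (-1)
    (fun t => by rw [e3, hL, α0]; ring) 0 1
  have i4 := log_increment_eq c4 (l' := fun t => L (1, t)) (by fun_prop) (-1)
    (fun t => by rw [e4, hL, α1]; ring) 0 1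
  have x1 := (hx e f.1 he h11 h21).1
  have x2 := (hx e f.2 he h12 h22).1
  have x3 := (hx f e.1 hf h11.symm h12.symm).1
  have x4 := (hx f e.2 hf h21.symm h22.symm).1
  rw [hθ_symm f.1, hθ_symm f.2] at x3 x4
  have hz : ((x e f.1 + x f e.2 : ℤ) : ℂ) * (Real.pi * I) =
      ((x f e.1 + x e f.2 : ℤ) : ℂ) * (Real.pi * I) := by
    push_cast
    linear_combination -x1 - x4 + x2 + x3 + i1 + i4 - i2 - i3
  exact_mod_cast mul_right_cancel₀ (mul_ne_zero (by exact_mod_cast Real.pi_ne_zero) I_ne_zero) hz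

theorem SimpleGraph.IsStringGraph.exists_halfTurns {V : Type*} [LinearOrder V] {G : SimpleGraph V}
    (hG : G.IsStringGraph) :
    ∃ x : V × V → V → ℤ,
      (∀ e w, G.Adj e.1 e.2 → Gᶜ.Adj e.1 w → Gᶜ.Adj e.2 w →
        (Even (x e w) ↔ (e.1 < w ↔ e.2 < w))) ∧
      (∀ e f, G.Adj e.1 e.2 → G.Adj f.1 f.2 → Gᶜ.Adj e.1 f.1 → Gᶜ.Adj e.1 f.2 →
        Gᶜ.Adj e.2 f.1 → Gᶜ.Adj e.2 f.2 → x e f.1 + x f e.2 = x f e.1 + x e f.2) := by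
  obtain ⟨γ, hγ⟩ := hG
  have : PathConnectedSpace unitInterval := isPathConnected_iff_pathConnectedSpace.1
    ((convex_Icc (0 : ℝ) 1).isPathConnected ⟨0, by simp⟩)
  let φ := Complex.orthonormalBasisOneI.repr.symm
  refine SimpleGraph.exists_halfTurns (fun v => φ '' Set.range (γ v))
    (fun v => (isPathConnected_range (γ v).continuous).image φ.continuous) fun v w h => ?_
  rw [← Set.image_inter φ.injective, Set.image_nonempty, hγ v w h]

/-! ### The surface of far pairs of the Heawood graph -/

instance : DecidableRel heawoodGraph.Adj := fun i j =>
  decidable_of_iff (i ≠ j ∧ ((j = i + 1 ∨ (i.val % 2 = 1 ∧ j = i + 5)) ∨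
    (i = j + 1 ∨ (j.val % 2 = 1 ∧ i = j + 5)))) Iff.rfl

/-- The 21 edges of the Heawood graph, each with its odd end first. -/
def heawoodEdges : Finset (Fin 14 × Fin 14) :=
  {e | e.1.val % 2 = 1 ∧ heawoodGraph.Adj e.1 e.2}

/-- The edges far from a given edge: no end of one is equal or adjacent to an end of the other. -/
def heawoodFarEdges (e : Fin 14 × Fin 14) : Finset (Fin 14 × Fin 14) :=
  {f ∈ heawoodEdges | heawoodGraphᶜ.Adj e.1 f.1 ∧ heawoodGraphᶜ.Adj e.1 f.2 ∧
    heawoodGraphᶜ.Adj e.2 f.1 ∧ heawoodGraphᶜ.Adj e.2 f.2}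

/-- The parity of the number of half turns: `1` if `w` lies between the ends of `e`, else `0`. -/
def betweenParity (e : Fin 14 × Fin 14) (w : Fin 14) : ℤ :=
  if (e.1 < w ↔ e.2 < w) then 0 else 1

/-- The edges far from `e` form an 8-cycle, so every vertex is on `0` or `2` of them. -/
theorem even_card_heawoodFarEdges : ∀ e ∈ heawoodEdges, ∀ w,
    Even (heawoodFarEdges e |>.filter fun f => f.1 = w).card ∧
    Even (heawoodFarEdges e |>.filter fun f => f.2 = w).card := by
  decide +kernel

/-- Half of this sum is the Bockstein of the class of the double cover, evaluated on the surface.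
The condition `e.1 < f.1` lists each unordered pair of far edges once, as far edges have different
odd ends. -/
theorem sum_betweenParity_heawoodFarEdges :
    (∑ e ∈ heawoodEdges, ∑ f ∈ heawoodFarEdges e with e.1 < f.1,
      (betweenParity e f.1 + betweenParity f e.2 - betweenParity f e.1 - betweenParity e f.2))
      % 4 = 2 := by
  decide +kernel

theorem Finset.sum_comp_eq_zero_of_even_card {ι κ : Type*} [DecidableEq κ] (s : Finset ι)
    (g : ι → κ) (h : ∀ k, Even (s.filter fun i => g i = k).card) (f : κ → ZMod 2) :
    ∑ i ∈ s, f (g i) = 0 := by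
  rw [Finset.sum_comp]
  refine Finset.sum_eq_zero fun k _ => ?_
  obtain ⟨m, hm⟩ := h k
  rw [hm, add_nsmul, CharTwo.add_self_eq_zero]

theorem heawoodFarEdges_comm {e f : Fin 14 × Fin 14} (he : e ∈ heawoodEdges) :
    f ∈ heawoodFarEdges e → f ∈ heawoodEdges ∧ e ∈ heawoodFarEdges f := by
  simp only [heawoodFarEdges, Finset.mem_filter]
  exact fun ⟨hf, h11, h12, h21, h22⟩ => ⟨hf, he, h11.symm, h21.symm, h12.symm, h22.symm⟩

/-- The squares over the Heawood graph form a surface without boundary: modulo `2` the boundaries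
of all of them cancel. -/
theorem sum_boundary_heawoodFarEdges (y : Fin 14 × Fin 14 → Fin 14 → ZMod 2) :
    ∑ e ∈ heawoodEdges, ∑ f ∈ heawoodFarEdges e with e.1 < f.1,
      ((y e f.1 + y e f.2) + (y f e.1 + y f e.2)) = 0 := by
  have hswap : ∑ e ∈ heawoodEdges, ∑ f ∈ heawoodFarEdges e with e.1 < f.1,
      (y f e.1 + y f e.2) =
      ∑ e ∈ heawoodEdges, ∑ f ∈ heawoodFarEdges e with ¬ e.1 < f.1, (y e f.1 + y e f.2) := by
    refine Finset.sum_comm' fun e f => ?_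
    simp only [Finset.mem_filter]
    constructor
    · rintro ⟨he, hf, hlt⟩
      obtain ⟨hf', he'⟩ := heawoodFarEdges_comm he hf
      exact ⟨⟨he', hlt.not_gt⟩, hf'⟩
    · rintro ⟨⟨he, hlt⟩, hf⟩
      obtain ⟨he', hf'⟩ := heawoodFarEdges_comm hf he
      exact ⟨he', hf', lt_of_le_of_ne (not_lt.1 hlt) (Finset.mem_filter.1 hf').2.1.ne⟩
  rw [Finset.sum_congr rfl fun e _ => Finset.sum_add_distrib
    (f := fun f : Fin 14 × Fin 14 => y e f.1 + y e f.2) (g := fun f => y f e.1 + y f e.2),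
    Finset.sum_add_distrib, hswap, ← Finset.sum_add_distrib]
  refine Finset.sum_eq_zero fun e he => ?_
  rw [Finset.sum_filter_add_sum_filter_not, Finset.sum_add_distrib,
    Finset.sum_comp_eq_zero_of_even_card _ _ (fun w => (even_card_heawoodFarEdges e he w).1) (y e),
    Finset.sum_comp_eq_zero_of_even_card _ _ (fun w => (even_card_heawoodFarEdges e he w).2) (y e),
    add_zero]

theorem mainTheorem3 : ¬ heawoodGraph.IsStringGraph := by
  intro h
  obtain ⟨x, hpar, hsq⟩ := h.exists_halfTurns
  -- The division is exact at every `(e, w)` for which `w` is far from `e`.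
  let y : Fin 14 × Fin 14 → Fin 14 → ℤ := fun e w => (x e w - betweenParity e w) / 2
  have hy : ∀ e w, heawoodGraph.Adj e.1 e.2 → heawoodGraphᶜ.Adj e.1 w → heawoodGraphᶜ.Adj e.2 w →
      x e w = betweenParity e w + 2 * y e w := by
    intro e w he h1 h2
    have := hpar e w he h1 h2
    rw [Int.even_iff] at this
    simp only [y, betweenParity]
    split_ifs with hb <;> simp only [hb, iff_true, iff_false] at this <;> omega
  have hbound : (∑ e ∈ heawoodEdges, ∑ f ∈ heawoodFarEdges e with e.1 < f.1,
      (y e f.1 + y f e.2 - y f e.1 - y e f.2)) % 2 = 0 := by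
    rw [← Int.dvd_iff_emod_eq_zero]
    refine (ZMod.intCast_zmod_eq_zero_iff_dvd _ 2).1 ?_
    rw [← sum_boundary_heawoodFarEdges fun e w => (y e w : ZMod 2)]
    push_cast
    refine Finset.sum_congr rfl fun e _ => Finset.sum_congr rfl fun f _ => ?_
    rw [CharTwo.sub_eq_add, CharTwo.sub_eq_add]
    ring
  have hzero : (∑ e ∈ heawoodEdges, ∑ f ∈ heawoodFarEdges e with e.1 < f.1,
      (betweenParity e f.1 + betweenParity f e.2 - betweenParity f e.1 - betweenParity e f.2)) +
      2 * (∑ e ∈ heawoodEdges, ∑ f ∈ heawoodFarEdges e with e.1 < f.1,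
      (y e f.1 + y f e.2 - y f e.1 - y e f.2)) = 0 := by
    simp_rw [Finset.mul_sum, ← Finset.sum_add_distrib]
    refine Finset.sum_eq_zero fun e he => Finset.sum_eq_zero fun f hf => ?_
    simp only [heawoodFarEdges, heawoodEdges, Finset.mem_filter, Finset.mem_univ, true_and]
      at he hf
    obtain ⟨⟨hf, h11, h12, h21, h22⟩, -⟩ := hf
    have := hsq e f he.2 hf.2 h11 h12 h21 h22
    rw [hy e f.1 he.2 h11 h21, hy e f.2 he.2 h12 h22, hy f e.1 hf.2 h11.symm h12.symm,
      hy f e.2 hf.2 h21.symm h22.symm] at this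
    linear_combination this
  have hs := sum_betweenParity_heawoodFarEdges
  omega
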